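/- There exist smooth Riemannian metrics $g_1, g_2$ on $\mathbb{R}^3$ such that the following hold. (1) For $i=1,2$, $g_i = u_i^4\,\delta$, where $\delta$ is the Euclidean metric and $u_i$ is a smooth, positive, radial function with $\Delta u_i \le 0$. (2) For $i=1,2$, $(\mathbb{R}^3,g_i)$ is asymptotically flat with nonnegative scalar curvature. That is: $g_i$ is complete; its scalar curvature is nonnegative and integrable with respect to the Riemannian volume; and for some compact $K$ and some $R>0$ there is a diffeomorphism from $\mathbb{R}^3\setminus K$ onto $\{|y|>R\}$ such that in the coordinates $y$ the metric is $\delta_{jk}+b_{jk}$ with $|b_{jk}| + r|\partial b_{jk}| + r^2|\partial\partial b_{jk}| = O(r^{-1})$ as $r=|y|\to\infty$. (3) $g_1=g_2$ outside some compact set. (4) $(\mathbb{R}^3,g_1)$ contains a stable minimal sphere: there is a smoothly embedded minimal two-sphere $\Sigma$ with a smooth unit normal $\nu$ such that $\int_\Sigma |\nabla\varphi|^2-(\mathrm{Ric}(\nu,\nu)+|A|^2)\varphi^2\,dA\ge 0$ for all $\varphi\in C^\infty(\Sigma)$, where $A$ is the second fundamental form of $\Sigma$. (5) $(\mathbb{R}^3,g_2)$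 contains no compact minimal surface: no nonempty compact surface without boundary admits a smooth minimal immersion (an immersion with vanishing mean curvature) into $(\mathbb{R}^3,g_2)$. -/

import Mathlib

open Set Filter Topology MeasureTheory
open scoped ContDiff Manifold ENNReal

noncomputable section

namespace MinimalSurfaceR3

/-! ### Riemannian metrics on three-space and their curvature, in the global standard chart -/

/-- Euclidean three-space. -/
abbrev E3 : Type := EuclideanSpace ℝ (Fin 3)

/-- The coordinate plane in which surfaces are parametrized. -/
abbrev E2 : Type := EuclideanSpace ℝ (Fin 2)

instance factFinrankE3 : Fact (Module.finrank ℝ E3 = 2 + 1) := ⟨by simp⟩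

/-- Smooth Riemannian metrics on the manifold `ℝ³`. -/
abbrev Metric3 : Type :=
  Bundle.ContMDiffRiemannianMetric 𝓘(ℝ, E3) ∞ E3 (fun x : E3 => TangentSpace 𝓘(ℝ, E3) x)

/-- Coordinate vectors. -/
def e3 (i : Fin 3) : E3 := EuclideanSpace.single i 1

/-- Coordinate vectors. -/
def e2 (a : Fin 2) : E2 := EuclideanSpace.single a 1

/-- The value `g_x(v, w)`. -/
def form (g : Metric3) (x v w : E3) : ℝ := g.inner x v w

/-- The partial derivative `∂_i f`. -/
def partialD (i : Fin 3) (f : E3 → ℝ) (x : E3) : ℝ := fderiv ℝ f x (e3 i)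

/-- The matrix `(g_{ij}(x))`. -/
def gram (g : Metric3) (x : E3) : Matrix (Fin 3) (Fin 3) ℝ :=
  Matrix.of fun i j => form g x (e3 i) (e3 j)

/-- Christoffel symbols
`Γ^k_{ij} = ½ g^{kl} (∂_i g_{jl} + ∂_j g_{il} - ∂_l g_{ij})`. -/
def christoffel (g : Metric3) (k i j : Fin 3) (x : E3) : ℝ :=
  (1 / 2 : ℝ) * ∑ l, (gram g x)⁻¹ k l *
    (partialD i (fun y => gram g y j l) x + partialD j (fun y => gram g y i l) x
      - partialD l (fun y => gram g y i j) x)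

/-- Ricci curvature
`R_{ij} = ∂_k Γ^k_{ij} - ∂_j Γ^k_{ik} + Γ^k_{kl} Γ^l_{ij} - Γ^k_{jl} Γ^l_{ik}`. -/
def ricci (g : Metric3) (i j : Fin 3) (x : E3) : ℝ :=
  (∑ k, (partialD k (christoffel g k i j) x - partialD j (christoffel g k i k) x)) +
    ∑ k, ∑ l, (christoffel g k k l x * christoffel g l i j x
      - christoffel g k j l x * christoffel g l i k x)

/-- `Ric_x(v, w)`. -/
def ricciForm (g : Metric3) (x v w : E3) : ℝ := ∑ i, ∑ j, ricci g i j x * v i * w j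

/-- Scalar curvature `g^{ij} R_{ij}`. -/
def scalarCurvature (g : Metric3) (x : E3) : ℝ := ∑ i, ∑ j, (gram g x)⁻¹ i j * ricci g i j x

/-- The Riemannian volume measure `√(det g) dx`. -/
def riemannianVolume (g : Metric3) : Measure E3 :=
  volume.withDensity fun x => ENNReal.ofReal (Real.sqrt (gram g x).det)

section Distance

open scoped Bundle

/-- The Riemannian distance of `g`: the infimum of the `g`-lengths of `C¹` paths. -/
def riemannianDist (g : Metric3) (x y : E3) : ℝ≥0∞ :=
  letI : Bundle.RiemannianBundle (fun x : E3 => TangentSpace 𝓘(ℝ, E3) x) := ⟨g.toRiemannianMetric⟩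
  Manifold.riemannianEDist 𝓘(ℝ, E3) x y

end Distance

/-- `(ℝ³, g)` is complete: Cauchy sequences for the Riemannian distance converge. -/
def IsCompleteMetric (g : Metric3) : Prop :=
  ∀ x : ℕ → E3,
    (∀ ε : ℝ≥0∞, 0 < ε → ∃ N, ∀ m ≥ N, ∀ n ≥ N, riemannianDist g (x m) (x n) < ε) →
    ∃ a : E3, Tendsto (fun n => riemannianDist g (x n) a) atTop (𝓝 0)

/-! ### Asymptotic flatness -/

/-- `b_{ij} = (ψ^* g)_{ij} - δ_{ij}`, where `ψ` is the inverse of a chart at infinity. -/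
def chartPerturbation (g : Metric3) (ψ : E3 → E3) (i j : Fin 3) (y : E3) : ℝ :=
  form g (ψ y) (fderiv ℝ ψ y (e3 i)) (fderiv ℝ ψ y (e3 j)) - if i = j then 1 else 0

/-- `(ℝ³, g)` is asymptotically flat (with one end): it is complete, the scalar curvature is
nonnegative and integrable, and the complement of some compact set is diffeomorphic to the
exterior of a ball so that, in the coordinates so defined, `g_{ij} = δ_{ij} + b_{ij}` with
`|b_{ij}| + r |∂ b_{ij}| + r² |∂∂ b_{ij}| = O(r⁻¹)`. -/
structure IsAsymptoticallyFlat (g : Metric3) : Prop where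
  complete : IsCompleteMetric g
  scalar_nonneg : ∀ x, 0 ≤ scalarCurvature g x
  scalar_integrable : Integrable (scalarCurvature g) (riemannianVolume g)
  end_flat : ∃ (K : Set E3) (R : ℝ) (Φ : OpenPartialHomeomorph E3 E3),
    IsCompact K ∧ 0 < R ∧ Φ.source = Kᶜ ∧ Φ.target = (Metric.closedBall (0 : E3) R)ᶜ ∧
    ContDiffOn ℝ ∞ Φ Φ.source ∧ ContDiffOn ℝ ∞ Φ.symm Φ.target ∧
    ∀ i j, (fun y => |chartPerturbation g Φ.symm i j y|
        + ‖y‖ * ‖fderiv ℝ (chartPerturbation g Φ.symm i j) y‖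
        + ‖y‖ ^ 2 * ‖fderiv ℝ (fderiv ℝ (chartPerturbation g Φ.symm i j)) y‖)
      =O[Bornology.cobounded E3] fun y => ‖y‖⁻¹

/-- `g = u⁴ δ` with `u` smooth, positive, radial and superharmonic. -/
structure IsRadialConformal (g : Metric3) (u : E3 → ℝ) : Prop where
  smooth : ContDiff ℝ ∞ u
  pos : ∀ x, 0 < u x
  radial : ∀ x y, ‖x‖ = ‖y‖ → u x = u y
  superharmonic : ∀ x, Laplacian.laplacian u x ≤ 0
  conformal : ∀ x v w : E3, form g x v w = u x ^ 4 * inner ℝ v w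

/-! ### Parametrized surfaces `X : ℝ² → (ℝ³, g)` -/

/-- The coordinate tangent vector `X_a = ∂_a X`. -/
def tangentVec (X : E2 → E3) (a : Fin 2) (y : E2) : E3 := fderiv ℝ X y (e2 a)

/-- The first fundamental form `h_{ab} = g(X_a, X_b)`. -/
def firstForm (g : Metric3) (X : E2 → E3) (y : E2) : Matrix (Fin 2) (Fin 2) ℝ :=
  Matrix.of fun a b => form g (X y) (tangentVec X a y) (tangentVec X b y)

/-- The covariant derivative `∇_{X_a} X_b = (∂_a ∂_b X^k + Γ^k_{ij} X_a^i X_b^j) e_k`. -/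
def covDeriv (g : Metric3) (X : E2 → E3) (a b : Fin 2) (y : E2) : E3 :=
  fderiv ℝ (tangentVec X b) y (e2 a) +
    ∑ k, (∑ i, ∑ j, christoffel g k i j (X y) * tangentVec X a y i * tangentVec X b y j) • e3 k

/-- The component of `v` that is `g`-normal to the surface. -/
def normalPart (g : Metric3) (X : E2 → E3) (y : E2) (v : E3) : E3 :=
  v - ∑ a, ∑ b, ((firstForm g X y)⁻¹ a b * form g (X y) v (tangentVec X a y)) • tangentVec X b y

/-- The (vector valued) second fundamental form `A_{ab} = (∇_{X_a} X_b)^⊥`. -/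
def secondForm (g : Metric3) (X : E2 → E3) (a b : Fin 2) (y : E2) : E3 :=
  normalPart g X y (covDeriv g X a b y)

/-- The mean curvature vector `h^{ab} A_{ab}`. -/
def meanCurvatureVec (g : Metric3) (X : E2 → E3) (y : E2) : E3 :=
  ∑ a, ∑ b, (firstForm g X y)⁻¹ a b • secondForm g X a b y

/-- `|A|² = h^{ac} h^{bd} g(A_{ab}, A_{cd})`. -/
def secondFormNormSq (g : Metric3) (X : E2 → E3) (y : E2) : ℝ :=
  ∑ a, ∑ b, ∑ c, ∑ d, (firstForm g X y)⁻¹ a c * (firstForm g X y)⁻¹ b d *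
    form g (X y) (secondForm g X a b y) (secondForm g X c d y)

/-- `|∇ψ|² = h^{ab} ∂_a ψ ∂_b ψ`. -/
def gradNormSq (g : Metric3) (X : E2 → E3) (ψ : E2 → ℝ) (y : E2) : ℝ :=
  ∑ a, ∑ b, (firstForm g X y)⁻¹ a b * fderiv ℝ ψ y (e2 a) * fderiv ℝ ψ y (e2 b)

/-- The area density `√(det h)`. -/
def areaDensity (g : Metric3) (X : E2 → E3) (y : E2) : ℝ := Real.sqrt (firstForm g X y).det

/-! ### Immersed surfaces `f : S → (ℝ³, g)` -/

section Surface

variable {S : Type} [TopologicalSpace S] [ChartedSpace E2 S]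

/-- `f` is a smooth immersion of the surface `S`. -/
def IsSmoothImmersion (f : S → E3) : Prop :=
  ContMDiff (𝓡 2) 𝓘(ℝ, E3) ∞ f ∧ ∀ p, Function.Injective (mfderiv (𝓡 2) 𝓘(ℝ, E3) f p)

/-- A map on `S` written in the chart at `p`. -/
def inChart {V : Type} (f : S → V) (p : S) : E2 → V := f ∘ (extChartAt (𝓡 2) p).symm

/-- The immersion `f` is minimal: its mean curvature vanishes identically. -/
def IsMinimal (g : Metric3) (f : S → E3) : Prop :=
  ∀ p, meanCurvatureVec g (inChart f p) (extChartAt (𝓡 2) p p) = 0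

/-- `ν` is a smooth `g`-unit normal field along `f`. -/
structure IsUnitNormal (g : Metric3) (f ν : S → E3) : Prop where
  smooth : ContMDiff (𝓡 2) 𝓘(ℝ, E3) ∞ ν
  unit : ∀ p, form g (f p) (ν p) (ν p) = 1
  normal : ∀ p a, form g (f p) (ν p) (tangentVec (inChart f p) a (extChartAt (𝓡 2) p p)) = 0

/-- The integrand `|∇φ|² - (Ric(ν, ν) + |A|²) φ²` of the second variation of area in the
direction `φ ν`. -/
def stabilityIntegrand (g : Metric3) (f ν : S → E3) (φ : S → ℝ) (p : S) : ℝ :=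
  gradNormSq g (inChart f p) (inChart φ p) (extChartAt (𝓡 2) p p) -
    (ricciForm g (f p) (ν p) (ν p) +
      secondFormNormSq g (inChart f p) (extChartAt (𝓡 2) p p)) * φ p ^ 2

variable (S) in
/-- A smooth partition of unity subordinate to the chart domains. -/
def chartPartition [IsManifold (𝓡 2) ∞ S] [T2Space S] [SigmaCompactSpace S] :
    SmoothPartitionOfUnity S (𝓡 2) S univ :=
  (SmoothPartitionOfUnity.exists_isSubordinate_chartAt_source (𝓡 2) S).choose

/-- The integral `∫_S Q dA` with respect to the area induced by `g` through `f`, for `S` compact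
and `Q` continuous: localize by a partition of unity and integrate `Q √(det h)` in the charts. -/
def surfaceIntegral [IsManifold (𝓡 2) ∞ S] [T2Space S] [SigmaCompactSpace S]
    (g : Metric3) (f : S → E3) (Q : S → ℝ) : ℝ :=
  ∑ᶠ p : S, ∫ y in (extChartAt (𝓡 2) p).target,
    inChart (chartPartition S p) p y * inChart Q p y * areaDensity g (inChart f p) y

/-- The (two-sided) minimal immersion `f` is stable: the second variation of area is nonnegative
for all normal variations. -/
def IsStable [IsManifold (𝓡 2) ∞ S] [T2Space S] [SigmaCompactSpace S]
    (g : Metric3) (f : S → E3) : Prop :=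
  ∃ ν : S → E3, IsUnitNormal g f ν ∧
    ∀ φ : S → ℝ, ContMDiff (𝓡 2) 𝓘(ℝ, ℝ) ∞ φ →
      0 ≤ surfaceIntegral g f (stabilityIntegrand g f ν φ)

end Surface

/-- `(ℝ³, g)` contains a stable minimal (embedded) two-sphere. -/
def ContainsStableMinimalSphere (g : Metric3) : Prop :=
  ∃ f : Metric.sphere (0 : E3) 1 → E3,
    IsEmbedding f ∧ IsSmoothImmersion f ∧ IsMinimal g f ∧ IsStable g f

/-- `(ℝ³, g)` contains a compact minimal surface: a nonempty compact surface without boundary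
that is minimally immersed (embedded or not, connected or not, orientable or not). -/
def ContainsCompactMinimalSurface (g : Metric3) : Prop :=
  ∃ (S : Type) (_ : TopologicalSpace S) (_ : ChartedSpace E2 S) (_ : IsManifold (𝓡 2) ∞ S)
    (_ : T2Space S) (_ : CompactSpace S) (_ : Nonempty S) (f : S → E3),
    IsSmoothImmersion f ∧ IsMinimal g f

end MinimalSurfaceR3

end

/-! Both metrics come from one family `u = F(|x|²)`, where `F` is `profile a`. For `|x|² ≥ 2a` it
equals `1 + 1/|x|`, the spatial Schwarzschild factor with horizon `|x| = 1`; for `|x|² ≤ a` it is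
constant. The interpolation multiplies the slope of `1/√t` by a nondecreasing cutoff. Since `1/|x|`
is harmonic, only the derivative of the cutoff survives in `Δu`, with a favourable sign
(`four_mul_deriv_profileSlope`). As the scalar curvature is `-8 u⁻⁵ Δu`, it is nonnegative and
compactly supported. Two members of the family agree near infinity, so the choice of `a` only
decides whether the horizon is kept.

The mean curvature of a coordinate sphere is a positive multiple of `F + 4tF'` at `t = |x|²`. For
small `a` a neighbourhood of the horizon is exactly Schwarzschild. There `F + 4F' = 0` at `t = 1`,
so the unit sphere is totally geodesic; its normal Ricci curvature is nonpositive, so the stability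
integrand is nonnegative pointwise (`HasProfile.containsStableMinimalSphere`).

For `a ≥ 4` the horizon is cut away and `F + 4tF' > 0` everywhere (`profile_meanConvex`). A compact
minimal surface would touch, from inside, the smallest centred coordinate sphere enclosing it,
contradicting the maximum principle (`HasProfile.not_isMinimal`). -/

noncomputable section

namespace MinimalSurfaceR3

/-! ### The radial profile -/

/-- The function `1 / √t`. -/
def invSqrt (t : ℝ) : ℝ := (√t)⁻¹

lemma invSqrt_pos {t : ℝ} (ht : 0 < t) : 0 < invSqrt t := by
  unfold invSqrt; positivity

lemma invSqrt_nonneg (t : ℝ) : 0 ≤ invSqrt t := by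
  unfold invSqrt; positivity

lemma mul_invSqrt_sq {t : ℝ} (ht : 0 < t) : t * invSqrt t ^ 2 = 1 := by
  unfold invSqrt
  rw [inv_pow, Real.sq_sqrt ht.le, mul_inv_cancel₀ ht.ne']

lemma invSqrt_norm_sq (x : E3) : invSqrt (‖x‖ ^ 2) = ‖x‖⁻¹ := by
  rw [invSqrt, Real.sqrt_sq (norm_nonneg x)]

lemma contDiffAt_invSqrt {t : ℝ} (ht : 0 < t) : ContDiffAt ℝ ∞ invSqrt t :=
  (Real.contDiffAt_sqrt ht.ne').inv (Real.sqrt_ne_zero'.2 ht)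

lemma hasDerivAt_invSqrt {t : ℝ} (ht : 0 < t) :
    HasDerivAt invSqrt (-(1 / 2) * invSqrt t ^ 3) t := by
  have h : √t ≠ 0 := Real.sqrt_ne_zero'.2 ht
  refine ((Real.hasDerivAt_sqrt ht.ne').inv h).congr_deriv ?_
  rw [invSqrt]
  field_simp

/-- A smooth nondecreasing cutoff, `0` up to `a` and `1` from `2 a` on. -/
def cutoff (a t : ℝ) : ℝ := Real.smoothTransition ((t - a) / a)

lemma contDiff_cutoff (a : ℝ) : ContDiff ℝ ∞ (cutoff a) := by
  unfold cutoff
  exact Real.smoothTransition.contDiff.comp (by fun_prop)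

lemma cutoff_nonneg (a t : ℝ) : 0 ≤ cutoff a t := Real.smoothTransition.nonneg _

lemma cutoff_le_one (a t : ℝ) : cutoff a t ≤ 1 := Real.smoothTransition.le_one _

lemma cutoff_eq_zero {a t : ℝ} (ha : 0 < a) (ht : t ≤ a) : cutoff a t = 0 :=
  Real.smoothTransition.zero_of_nonpos (div_nonpos_of_nonpos_of_nonneg (by linarith) ha.le)

lemma cutoff_eq_one {a t : ℝ} (ha : 0 < a) (ht : 2 * a ≤ t) : cutoff a t = 1 :=
  Real.smoothTransition.one_of_one_le ((one_le_div ha).2 (by linarith))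

lemma monotone_cutoff {a : ℝ} (ha : 0 < a) : Monotone (cutoff a) := fun s t hst =>
  Real.smoothTransition.monotone (by gcongr)

/-- The derivative of `profile`. -/
def profileSlope (a t : ℝ) : ℝ := -(1 / 2) * (invSqrt t ^ 3 * cutoff a t)

/-- A smooth function on the line equal to `1 + 1 / √t` for `t ≥ 2 a` and constant for `t ≤ a`,
such that `x ↦ profile a (‖x‖²)` is superharmonic. -/
def profile (a t : ℝ) : ℝ := 1 + invSqrt (2 * a) + ∫ s in (2 * a)..t, profileSlope a s

lemma profileSlope_nonpos (a t : ℝ) : profileSlope a t ≤ 0 := by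
  have := mul_nonneg (pow_nonneg (invSqrt_nonneg t) 3) (cutoff_nonneg a t)
  unfold profileSlope; linarith

lemma profileSlope_eq_zero {a t : ℝ} (ha : 0 < a) (ht : t ≤ a) : profileSlope a t = 0 := by
  simp [profileSlope, cutoff_eq_zero ha ht]

lemma profileSlope_eq {a t : ℝ} (ha : 0 < a) (ht : 2 * a ≤ t) :
    profileSlope a t = -(1 / 2) * invSqrt t ^ 3 := by
  simp [profileSlope, cutoff_eq_one ha ht]

/-- The singularity of `invSqrt` at `0` is harmless because the cutoff vanishes identically below
`a`. -/
lemma contDiff_profileSlope {a : ℝ} (ha : 0 < a) : ContDiff ℝ ∞ (profileSlope a) := by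
  refine contDiff_iff_contDiffAt.2 fun t => ?_
  rcases lt_or_ge t a with h | h
  · refine (contDiffAt_const (c := (0 : ℝ))).congr_of_eventuallyEq ?_
    filter_upwards [Iio_mem_nhds h] with s hs using profileSlope_eq_zero ha (le_of_lt hs)
  · exact contDiffAt_const.mul
      (((contDiffAt_invSqrt (ha.trans_le h)).pow 3).mul (contDiff_cutoff a).contDiffAt)

lemma hasDerivAt_profile {a : ℝ} (ha : 0 < a) (t : ℝ) :
    HasDerivAt (profile a) (profileSlope a t) t := by
  have hc := (contDiff_profileSlope ha).continuous
  exact (intervalIntegral.integral_hasDerivAt_right (hc.intervalIntegrable _ _)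
    hc.aestronglyMeasurable.stronglyMeasurableAtFilter hc.continuousAt).const_add _

lemma deriv_profile {a : ℝ} (ha : 0 < a) : deriv (profile a) = profileSlope a :=
  funext fun t => (hasDerivAt_profile ha t).deriv

lemma contDiff_profile {a : ℝ} (ha : 0 < a) : ContDiff ℝ ∞ (profile a) := by
  rw [contDiff_infty_iff_deriv]
  exact ⟨fun t => (hasDerivAt_profile ha t).differentiableAt,
    deriv_profile ha ▸ contDiff_profileSlope ha⟩

lemma antitone_profile {a : ℝ} (ha : 0 < a) : Antitone (profile a) :=
  antitone_of_deriv_nonpos (fun t => (hasDerivAt_profile ha t).differentiableAt)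
    fun t => deriv_profile ha ▸ profileSlope_nonpos a t

lemma profile_eq {a t : ℝ} (ha : 0 < a) (ht : 2 * a ≤ t) : profile a t = 1 + invSqrt t := by
  have key : ∫ s in (2 * a)..t, profileSlope a s = invSqrt t - invSqrt (2 * a) := by
    refine intervalIntegral.integral_eq_sub_of_hasDerivAt (fun s hs => ?_)
      ((contDiff_profileSlope ha).continuous.intervalIntegrable _ _)
    rw [uIcc_of_le ht] at hs
    rw [profileSlope_eq ha hs.1]
    exact hasDerivAt_invSqrt (by linarith [hs.1])
  rw [profile, key]; ring

/-- By monotonicity it suffices to look far out, where the explicit formula applies. -/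
lemma one_lt_profile {a : ℝ} (ha : 0 < a) (t : ℝ) : 1 < profile a t := by
  have h1 := antitone_profile ha (le_max_left t (2 * a))
  rw [profile_eq ha (le_max_right t (2 * a))] at h1
  have := invSqrt_pos (t := max t (2 * a)) (lt_max_of_lt_right (by linarith))
  linarith

lemma profile_pos {a : ℝ} (ha : 0 < a) (t : ℝ) : 0 < profile a t :=
  zero_lt_one.trans (one_lt_profile ha t)

/-- The left side is the Laplacian of `x ↦ profile a (‖x‖²)` at `t = ‖x‖²`. Terms in the
undifferentiated cutoff cancel by harmonicity of `1/|x|`. -/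
lemma four_mul_deriv_profileSlope {a t : ℝ} (ha : 0 < a) :
    4 * t * deriv (profileSlope a) t + 6 * profileSlope a t
      = -2 * invSqrt t * deriv (cutoff a) t := by
  rcases lt_or_ge t a with h | h
  · have h1 : profileSlope a =ᶠ[𝓝 t] fun _ => 0 := by
      filter_upwards [Iio_mem_nhds h] with s hs using profileSlope_eq_zero ha (le_of_lt hs)
    have h2 : cutoff a =ᶠ[𝓝 t] fun _ => 0 := by
      filter_upwards [Iio_mem_nhds h] with s hs using cutoff_eq_zero ha (le_of_lt hs)
    simp [h1.deriv_eq, h2.deriv_eq, profileSlope_eq_zero ha h.le]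
  · have h0 : 0 < t := ha.trans_le h
    have hc : HasDerivAt (cutoff a) (deriv (cutoff a) t) t :=
      ((contDiff_cutoff a).differentiable (by simp)).differentiableAt.hasDerivAt
    have hd : deriv (profileSlope a) t = _ :=
      ((((hasDerivAt_invSqrt h0).pow 3).mul hc).const_mul (-(1 / 2))).deriv
    rw [hd, profileSlope]
    have h2 := mul_invSqrt_sq h0
    simp only [Pi.pow_apply]
    norm_num
    linear_combination (3 * invSqrt t ^ 3 * cutoff a t - 2 * invSqrt t * deriv (cutoff a) t) * h2

lemma profile_superharmonic {a t : ℝ} (ha : 0 < a) :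
    4 * t * deriv (profileSlope a) t + 6 * profileSlope a t ≤ 0 := by
  rw [four_mul_deriv_profileSlope ha]
  have := mul_nonneg (invSqrt_nonneg t) ((monotone_cutoff ha).deriv_nonneg (x := t))
  linarith

lemma profile_harmonic {a t : ℝ} (ha : 0 < a) (ht : 2 * a < t) :
    4 * t * deriv (profileSlope a) t + 6 * profileSlope a t = 0 := by
  have h2 : cutoff a =ᶠ[𝓝 t] fun _ => 1 := by
    filter_upwards [Ioi_mem_nhds ht] with s hs using cutoff_eq_one ha (le_of_lt hs)
  rw [four_mul_deriv_profileSlope ha, h2.deriv_eq]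
  simp

/-- Coordinate spheres are strictly mean convex when `a ≥ 4`. -/
lemma profile_meanConvex {a t : ℝ} (ha : 4 ≤ a) :
    0 < profile a t + 4 * t * profileSlope a t := by
  have ha' : 0 < a := by linarith
  have h1 := one_lt_profile ha' t
  rcases lt_or_ge t a with h | h
  · rw [profileSlope_eq_zero ha' h.le]; linarith
  · have h0 : 0 < t := by linarith
    have h2 := mul_invSqrt_sq h0
    have h3 := invSqrt_nonneg t
    -- Here `a ≥ 4` enters: the negative term below is then at least `-1`, while the profile exceeds
    -- `1`.
    have h4 : invSqrt t ≤ 1 / 2 := by nlinarith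
    have h5 : 4 * t * profileSlope a t = -2 * (invSqrt t * cutoff a t) := by
      rw [profileSlope]
      linear_combination (-2 * invSqrt t * cutoff a t) * h2
    rw [h5]
    nlinarith [cutoff_le_one a t, cutoff_nonneg a t]

/-! ### Rotationally symmetric conformally flat metrics -/

/-- `u⁴ δ` for a smooth positive function `u`. -/
def conformalMetric (u : E3 → ℝ) (hu : ContDiff ℝ ∞ u) (hpos : ∀ x, 0 < u x) : Metric3 where
  inner x := u x ^ 4 • (riemannianMetricVectorSpace E3).inner x
  symm x v w := by
    change u x ^ 4 * inner ℝ (show E3 from v) (show E3 from w)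
      = u x ^ 4 * inner ℝ (show E3 from w) (show E3 from v)
    rw [real_inner_comm]
  pos x v hv := mul_pos (pow_pos (hpos x) 4)
    (real_inner_self_pos.2 (show (show E3 from v) ≠ 0 from hv))
  isVonNBounded x := by
    change Bornology.IsVonNBounded ℝ {v : E3 | u x ^ 4 * inner ℝ v v < 1}
    -- The unit ball of `u⁴ δ` is the Euclidean ball of radius `u⁻²`.
    refine (NormedSpace.isVonNBounded_ball ℝ E3 (u x ^ 2)⁻¹).subset fun v hv => ?_
    have h : 0 < u x ^ 2 := pow_pos (hpos x) 2
    rw [mem_ofPred_eq, real_inner_self_eq_norm_sq] at hv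
    rw [mem_ball_zero_iff, ← one_div, lt_div_iff₀ h,
      ← abs_of_nonneg (mul_nonneg (norm_nonneg v) h.le),
      ← sq_lt_one_iff_abs_lt_one]
    linarith
  contMDiff := ContMDiff.smul_section (hu.pow 4).contMDiff
    ((riemannianMetricVectorSpace E3).contMDiff.of_le le_top)

lemma form_conformalMetric {u : E3 → ℝ} (hu : ContDiff ℝ ∞ u) (hpos : ∀ x, 0 < u x)
    (x v w : E3) : form (conformalMetric u hu hpos) x v w = u x ^ 4 * inner ℝ v w := rfl

/-- `g = F(|x|²)⁴ δ` for a smooth positive function `F`. -/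
structure HasProfile (g : Metric3) (F : ℝ → ℝ) : Prop where
  smooth : ContDiff ℝ ∞ F
  pos : ∀ t, 0 < F t
  form_eq : ∀ x v w : E3, form g x v w = F (‖x‖ ^ 2) ^ 4 * inner ℝ v w

lemma exists_hasProfile {F : ℝ → ℝ} (hF : ContDiff ℝ ∞ F) (hpos : ∀ t, 0 < F t) :
    ∃ g : Metric3, HasProfile g F :=
  ⟨conformalMetric (fun x => F (‖x‖ ^ 2)) (hF.comp (contDiff_norm_sq ℝ)) fun _ => hpos _,
    hF, hpos, form_conformalMetric _ _⟩

/-- Using `‖x‖²` as the radial variable keeps all derivatives free of singularities at the origin.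
-/
lemma hasFDerivAt_radial {G : ℝ → ℝ} {G' : ℝ} {x : E3} (hG : HasDerivAt G G' (‖x‖ ^ 2)) :
    HasFDerivAt (fun y : E3 => G (‖y‖ ^ 2)) ((2 * G') • innerSL ℝ x) x := by
  have := hG.comp_hasFDerivAt x (hasStrictFDerivAt_norm_sq x).hasFDerivAt
  refine this.congr_fderiv ?_
  ext v
  simp
  ring

lemma inner_e3 (x : E3) (i : Fin 3) : inner ℝ x (e3 i) = x i := by
  simp [e3, EuclideanSpace.inner_single_right]

lemma inner_e3_e3 (i j : Fin 3) : inner ℝ (e3 i) (e3 j) = if i = j then 1 else 0 := by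
  simp [e3, EuclideanSpace.inner_single_right, eq_comm]

lemma partialD_radial {G : ℝ → ℝ} {G' : ℝ} {x : E3} (hG : HasDerivAt G G' (‖x‖ ^ 2)) (i : Fin 3) :
    partialD i (fun y : E3 => G (‖y‖ ^ 2)) x = 2 * G' * x i := by
  rw [partialD, (hasFDerivAt_radial hG).fderiv]
  simp [inner_e3]

lemma norm_sq_eq_sum (x : E3) : ‖x‖ ^ 2 = x 0 ^ 2 + x 1 ^ 2 + x 2 ^ 2 := by
  rw [EuclideanSpace.real_norm_sq_eq, Fin.sum_univ_three]

namespace HasProfile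

variable {g : Metric3} {F : ℝ → ℝ}

lemma hasDerivAt (h : HasProfile g F) (t : ℝ) : HasDerivAt F (deriv F t) t :=
  (h.smooth.differentiable (by simp)).differentiableAt.hasDerivAt

lemma contDiff_deriv (h : HasProfile g F) : ContDiff ℝ ∞ (deriv F) :=
  (contDiff_infty_iff_deriv.1 h.smooth).2

lemma hasDerivAt_deriv (h : HasProfile g F) (t : ℝ) : HasDerivAt (deriv F) (deriv (deriv F) t) t :=
  (h.contDiff_deriv.differentiable (by simp)).differentiableAt.hasDerivAt

lemma gram_eq (h : HasProfile g F) (x : E3) : gram g x = (F (‖x‖ ^ 2) ^ 4) • 1 := by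
  ext i j
  simp [gram, h.form_eq, inner_e3_e3, Matrix.one_apply]

lemma gram_apply (h : HasProfile g F) (x : E3) (i j : Fin 3) :
    gram g x i j = F (‖x‖ ^ 2) ^ 4 * if i = j then 1 else 0 := by
  simp [h.gram_eq, Matrix.one_apply]

lemma gram_inv (h : HasProfile g F) (x : E3) (i j : Fin 3) :
    (gram g x)⁻¹ i j = (F (‖x‖ ^ 2) ^ 4)⁻¹ * if i = j then 1 else 0 := by
  have h0 : F (‖x‖ ^ 2) ^ 4 ≠ 0 := (pow_pos (h.pos _) 4).ne'
  have : (gram g x)⁻¹ = (F (‖x‖ ^ 2) ^ 4)⁻¹ • 1 := by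
    rw [h.gram_eq]
    refine Matrix.inv_eq_right_inv ?_
    simp [smul_smul, h0]
  simp [this, Matrix.one_apply]

lemma gram_det (h : HasProfile g F) (x : E3) : (gram g x).det = F (‖x‖ ^ 2) ^ 12 := by
  rw [h.gram_eq, Matrix.det_smul, Matrix.det_one]
  simp [← pow_mul]

end HasProfile

/-- The coefficient `4 F' / F` of the Christoffel symbols of `F(|x|²)⁴ δ`. -/
def christoffelCoeff (F : ℝ → ℝ) (t : ℝ) : ℝ := 4 * deriv F t / F t

/-! ### Christoffel symbols, Ricci and scalar curvature of `F(|x|²)⁴ δ`. -/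

namespace HasProfile

variable {g : Metric3} {F : ℝ → ℝ}

lemma partialD_gram (h : HasProfile g F) (x : E3) (k i j : Fin 3) :
    partialD k (fun y => gram g y i j) x
      = 8 * F (‖x‖ ^ 2) ^ 3 * deriv F (‖x‖ ^ 2) * x k * if i = j then 1 else 0 := by
  simp only [h.gram_apply]
  rw [partialD_radial (G := fun t => F t ^ 4 * if i = j then 1 else 0)
    (((h.hasDerivAt _).pow 4).mul_const _)]
  push_cast
  ring

/-- The metric is `e^{2f} δ` with `f = 2 log F(|x|²)`, and `∂_i f` is `christoffelCoeff F (‖x‖²) * x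
i`. Since the inverse metric is diagonal, only `l = k` contributes. -/
lemma christoffel_eq (h : HasProfile g F) (x : E3) (k i j : Fin 3) :
    christoffel g k i j x = christoffelCoeff F (‖x‖ ^ 2) *
      ((if j = k then 1 else 0) * x i + (if i = k then 1 else 0) * x j
        - (if i = j then 1 else 0) * x k) := by
  have h0 : F (‖x‖ ^ 2) ≠ 0 := (h.pos _).ne'
  rw [christoffel, Finset.sum_eq_single k]
  · simp only [h.partialD_gram, h.gram_inv, christoffelCoeff, if_true]
    field_simp
    ring
  · intro l _ hl
    simp [h.gram_inv, hl.symm]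
  · simp

lemma hasDerivAt_christoffelCoeff (h : HasProfile g F) (t : ℝ) :
    HasDerivAt (christoffelCoeff F) (deriv (christoffelCoeff F) t) t := by
  have := ((h.hasDerivAt_deriv t).const_mul 4).div (h.hasDerivAt t) (h.pos t).ne'
  exact this.differentiableAt.hasDerivAt

lemma deriv_christoffelCoeff (h : HasProfile g F) (t : ℝ) :
    deriv (christoffelCoeff F) t
      = 4 * deriv (deriv F) t / F t - 4 * deriv F t ^ 2 / F t ^ 2 := by
  have h0 := (h.pos t).ne'
  have := ((h.hasDerivAt_deriv t).const_mul 4).div (h.hasDerivAt t) h0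
  rw [show christoffelCoeff F = (fun y => 4 * deriv F y) / F from rfl, this.deriv]
  field_simp

lemma partialD_christoffel (h : HasProfile g F) (x : E3) (m k i j : Fin 3) :
    partialD m (christoffel g k i j) x =
      2 * deriv (christoffelCoeff F) (‖x‖ ^ 2) * x m *
      ((if j = k then 1 else 0) * x i + (if i = k then 1 else 0) * x j
        - (if i = j then 1 else 0) * x k) +
      christoffelCoeff F (‖x‖ ^ 2) *
      ((if j = k then 1 else 0) * (if i = m then 1 else 0)
        + (if i = k then 1 else 0) * (if j = m then 1 else 0)
        - (if i = j then 1 else 0) * (if k = m then 1 else 0)) := by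
  have hx : ∀ l : Fin 3, HasFDerivAt (fun y : E3 => y l) (EuclideanSpace.proj l : E3 →L[ℝ] ℝ) x :=
    fun l => (EuclideanSpace.proj l : E3 →L[ℝ] ℝ).hasFDerivAt
  have key := (hasFDerivAt_radial (h.hasDerivAt_christoffelCoeff (‖x‖ ^ 2))).mul
    ((((hx i).const_mul (if j = k then 1 else 0)).add
      ((hx j).const_mul (if i = k then 1 else 0))).sub
      ((hx k).const_mul (if i = j then 1 else 0)))
  rw [show christoffel g k i j = _ from funext fun y => h.christoffel_eq y k i j, partialD]
  refine (congrArg (fun T : E3 →L[ℝ] ℝ => T (e3 m)) key.fderiv).trans ?_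
  have he : ∀ l : Fin 3, (EuclideanSpace.proj l : E3 →L[ℝ] ℝ) (e3 m) = if l = m then 1 else 0 :=
    fun l => by simp [e3]
  simp only [add_apply, sub_apply, smul_apply, innerSL_apply_apply, inner_e3, he,
    smul_eq_mul, Pi.add_apply, Pi.sub_apply]
  ring

lemma ricci_eq (h : HasProfile g F) (x : E3) (i j : Fin 3) :
    ricci g i j x = (christoffelCoeff F (‖x‖ ^ 2) ^ 2 - 2 * deriv (christoffelCoeff F) (‖x‖ ^ 2))
        * x i * x j
      - (4 * christoffelCoeff F (‖x‖ ^ 2) + 2 * deriv (christoffelCoeff F) (‖x‖ ^ 2) * ‖x‖ ^ 2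
        + christoffelCoeff F (‖x‖ ^ 2) ^ 2 * ‖x‖ ^ 2) * if i = j then 1 else 0 := by
  simp only [ricci, h.partialD_christoffel, h.christoffel_eq]
  generalize christoffelCoeff F (‖x‖ ^ 2) = L
  generalize deriv (christoffelCoeff F) (‖x‖ ^ 2) = M
  rw [norm_sq_eq_sum]
  fin_cases i <;> fin_cases j <;> simp [Fin.sum_univ_three] <;> ring

/-- This is `R = -8 u⁻⁵ Δu`: by `laplacian_radial` the last factor is the Laplacian of the conformal
factor. -/
lemma scalarCurvature_eq (h : HasProfile g F) (x : E3) :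
    scalarCurvature g x = -8 * (F (‖x‖ ^ 2) ^ 5)⁻¹ *
      (4 * ‖x‖ ^ 2 * deriv (deriv F) (‖x‖ ^ 2) + 6 * deriv F (‖x‖ ^ 2)) := by
  have h0 := (h.pos (‖x‖ ^ 2)).ne'
  have key : scalarCurvature g x = (F (‖x‖ ^ 2) ^ 4)⁻¹ *
      (-8 * deriv (christoffelCoeff F) (‖x‖ ^ 2) * ‖x‖ ^ 2
        - 12 * christoffelCoeff F (‖x‖ ^ 2) - 2 * christoffelCoeff F (‖x‖ ^ 2) ^ 2 * ‖x‖ ^ 2) := by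
    simp only [scalarCurvature, h.gram_inv, h.ricci_eq, Fin.sum_univ_three]
    simp
    linear_combination (F (‖x‖ ^ 2) ^ 4)⁻¹ * (2 * deriv (christoffelCoeff F) (‖x‖ ^ 2)
      - christoffelCoeff F (‖x‖ ^ 2) ^ 2) * norm_sq_eq_sum x
  rw [key, h.deriv_christoffelCoeff, christoffelCoeff]
  field_simp
  ring

end HasProfile

lemma laplacian_radial {F : ℝ → ℝ} (hF : ContDiff ℝ ∞ F) (x : E3) :
    Laplacian.laplacian (fun y : E3 => F (‖y‖ ^ 2)) x =
      4 * ‖x‖ ^ 2 * deriv (deriv F) (‖x‖ ^ 2) + 6 * deriv F (‖x‖ ^ 2) := by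
  have h1 : ∀ t, HasDerivAt F (deriv F t) t := fun t =>
    (hF.differentiable (by simp)).differentiableAt.hasDerivAt
  have h2 : ∀ t, HasDerivAt (deriv F) (deriv (deriv F) t) t := fun t =>
    ((contDiff_infty_iff_deriv.1 hF).2.differentiable (by simp)).differentiableAt.hasDerivAt
  have hf : fderiv ℝ (fun y : E3 => F (‖y‖ ^ 2))
      = fun y => (2 * deriv F (‖y‖ ^ 2)) • innerSL ℝ y :=
    funext fun y => (hasFDerivAt_radial (h1 _)).fderiv
  have hff := ((hasFDerivAt_radial (h2 (‖x‖ ^ 2))).const_mul 2).smul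
    ((innerSL ℝ : E3 →L[ℝ] E3 →L[ℝ] ℝ).hasFDerivAt (x := x))
  have key : ∀ i, iteratedFDeriv ℝ 2 (fun y : E3 => F (‖y‖ ^ 2)) x ![e3 i, e3 i]
      = 4 * deriv (deriv F) (‖x‖ ^ 2) * x i ^ 2 + 2 * deriv F (‖x‖ ^ 2) := fun i => by
    rw [iteratedFDeriv_two_apply, hf]
    refine (congrArg (fun T : E3 →L[ℝ] E3 →L[ℝ] ℝ => T (e3 i) (e3 i)) hff.fderiv).trans ?_
    change 2 * deriv F (‖x‖ ^ 2) * inner ℝ (e3 i) (e3 i)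
      + 2 * (2 * deriv (deriv F) (‖x‖ ^ 2) * inner ℝ x (e3 i)) * inner ℝ x (e3 i) = _
    rw [inner_e3_e3, inner_e3 x, if_pos rfl]
    ring
  rw [InnerProductSpace.laplacian_eq_iteratedFDeriv_orthonormalBasis _
    (EuclideanSpace.basisFun (Fin 3) ℝ)]
  simp only [EuclideanSpace.basisFun_apply]
  change ∑ i, iteratedFDeriv ℝ 2 (fun y : E3 => F (‖y‖ ^ 2)) x ![e3 i, e3 i] = _
  simp only [key, Fin.sum_univ_three]
  linear_combination (-4 * deriv (deriv F) (‖x‖ ^ 2)) * norm_sq_eq_sum x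

/-! ### Completeness -/

section Completeness

open scoped Bundle

namespace HasProfile

variable {g : Metric3} {F : ℝ → ℝ}

lemma enorm_eq (h : HasProfile g F) (x : E3) (v : TangentSpace 𝓘(ℝ, E3) x) :
    (letI : Bundle.RiemannianBundle (fun x : E3 => TangentSpace 𝓘(ℝ, E3) x) :=
      ⟨g.toRiemannianMetric⟩
    ‖v‖ₑ) = ENNReal.ofReal (F (‖x‖ ^ 2) ^ 2) * @enorm E3 _ v := by
  let : Bundle.RiemannianBundle (fun x : E3 => TangentSpace 𝓘(ℝ, E3) x) :=
      ⟨g.toRiemannianMetric⟩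
  have h1 : ‖v‖ = F (‖x‖ ^ 2) ^ 2 * @norm E3 _ v := by
    have h2 (w : E3) : √(form g x w w) = F (‖x‖ ^ 2) ^ 2 * ‖w‖ := by
      rw [h.form_eq, real_inner_self_eq_norm_sq,
        show F (‖x‖ ^ 2) ^ 4 * ‖w‖ ^ 2 = (F (‖x‖ ^ 2) ^ 2 * ‖w‖) ^ 2 by ring]
      exact Real.sqrt_sq (by positivity)
    exact (norm_eq_sqrt_real_inner v).trans (h2 v)
  rw [← ofReal_norm, h1, ENNReal.ofReal_mul (by positivity)]
  exact congrArg (ENNReal.ofReal (F (‖x‖ ^ 2) ^ 2) * ·) (ofReal_norm (E := E3) v)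

/-- A conformal factor at least `1` makes every path at least as long as its Euclidean length. -/
lemma edist_le_riemannianDist (h : HasProfile g F) (h1 : ∀ t, 1 ≤ F t) (x y : E3) :
    edist x y ≤ riemannianDist g x y := by
  let : Bundle.RiemannianBundle (fun x : E3 => TangentSpace 𝓘(ℝ, E3) x) :=
      ⟨g.toRiemannianMetric⟩
  rw [riemannianDist, Manifold.riemannianEDist]
  refine le_iInf₂ fun γ hγ => ?_
  have D : ContDiffOn ℝ 1 (γ ∘ projIcc 0 1 zero_le_one) (Icc 0 1) :=
    contMDiffOn_iff_contDiffOn.mp (hγ.comp_contMDiffOn contMDiffOn_projIcc)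
  rw [Manifold.lintegral_norm_mfderiv_Icc_eq_pathELength_projIcc,
    Manifold.pathELength_eq_lintegral_mfderivWithin_Icc]
  simp only [mfderivWithin_eq_fderivWithin, h.enorm_eq]
  have e0 : (γ ∘ projIcc 0 1 zero_le_one) 0 = x := by simp
  have e1 : (γ ∘ projIcc 0 1 zero_le_one) 1 = y := by simp
  rw [show edist x y = ‖(γ ∘ projIcc 0 1 zero_le_one) 1 - (γ ∘ projIcc 0 1 zero_le_one) 0‖ₑ by
    rw [e0, e1, edist_comm, edist_eq_enorm_sub]]
  refine (enorm_sub_le_lintegral_derivWithin_Icc_of_contDiffOn_Icc D zero_le_one).trans ?_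
  refine lintegral_mono fun t => ?_
  refine le_trans ?_ (le_mul_of_one_le_left zero_le ?_)
  · exact le_rfl
  · exact ENNReal.one_le_ofReal.2 (one_le_pow₀ (h1 _))

/-- Test with the straight segment. -/
lemma riemannianDist_le (h : HasProfile g F) {C : ℝ} (hC : ∀ t, 0 ≤ t → F t ≤ C) (x y : E3) :
    riemannianDist g x y ≤ ENNReal.ofReal (C ^ 2) * edist x y := by
  let : Bundle.RiemannianBundle (fun x : E3 => TangentSpace 𝓘(ℝ, E3) x) :=
      ⟨g.toRiemannianMetric⟩
  let γ := ContinuousAffineMap.lineMap (R := ℝ) x y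
  have key : Manifold.riemannianEDist 𝓘(ℝ, E3) x y ≤ Manifold.pathELength 𝓘(ℝ, E3) γ 0 1 := by
    apply Manifold.riemannianEDist_le_pathELength ?_
      (by simp [γ, ContinuousAffineMap.coe_lineMap_eq])
      (by simp [γ, ContinuousAffineMap.coe_lineMap_eq]) zero_le_one
    rw [contMDiffOn_iff_contDiffOn]
    exact γ.contDiff.contDiffOn
  refine le_trans key ?_
  rw [Manifold.pathELength_eq_lintegral_mfderivWithin_Icc, ← lintegral_fderiv_lineMap_eq_edist,
    ← lintegral_const_mul' _ _ ENNReal.ofReal_ne_top]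
  refine lintegral_mono fun t => ?_
  rw [h.enorm_eq, mfderivWithin_eq_fderivWithin]
  refine mul_le_mul' (ENNReal.ofReal_le_ofReal ?_) le_rfl
  have h2 := (h.pos (‖γ t‖ ^ 2)).le
  gcongr
  exact hC _ (sq_nonneg _)

/-- The Riemannian and Euclidean distances are bi-Lipschitz equivalent, so completeness is inherited
from `ℝ³`. -/
lemma isCompleteMetric (h : HasProfile g F) (h1 : ∀ t, 1 ≤ F t) {C : ℝ}
    (hC : ∀ t, 0 ≤ t → F t ≤ C) : IsCompleteMetric g := by
  intro x hx
  have hcauchy : CauchySeq x := by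
    refine EMetric.cauchySeq_iff.2 fun ε hε => ?_
    obtain ⟨N, hN⟩ := hx ε hε
    exact ⟨N, fun m hm n hn => (h.edist_le_riemannianDist h1 _ _).trans_lt (hN m hm n hn)⟩
  obtain ⟨a, ha⟩ := cauchySeq_tendsto_of_complete hcauchy
  refine ⟨a, tendsto_of_tendsto_of_tendsto_of_le_of_le tendsto_const_nhds ?_
    (fun _ => zero_le) fun n => h.riemannianDist_le hC (x n) a⟩
  simpa using ENNReal.Tendsto.const_mul (tendsto_iff_edist_tendsto_0.1 ha)
    (Or.inr ENNReal.ofReal_ne_top)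

end HasProfile

end Completeness

/-! ### Asymptotic flatness -/

lemma norm_fderiv_radial_le {G : ℝ → ℝ} {G' : ℝ} {x : E3} (hG : HasDerivAt G G' (‖x‖ ^ 2)) :
    ‖fderiv ℝ (fun y : E3 => G (‖y‖ ^ 2)) x‖ ≤ 2 * |G'| * ‖x‖ := by
  rw [(hasFDerivAt_radial hG).fderiv, norm_smul, innerSL_apply_norm, Real.norm_eq_abs, abs_mul,
    abs_two]

lemma norm_fderiv_fderiv_radial_le {G G' : ℝ → ℝ} {G'' : ℝ} {x : E3}
    (hG : ∀ t, HasDerivAt G (G' t) t) (hG' : HasDerivAt G' G'' (‖x‖ ^ 2)) :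
    ‖fderiv ℝ (fderiv ℝ (fun y : E3 => G (‖y‖ ^ 2))) x‖
      ≤ 2 * |G' (‖x‖ ^ 2)| + 4 * |G''| * ‖x‖ ^ 2 := by
  have hf : fderiv ℝ (fun y : E3 => G (‖y‖ ^ 2)) = fun y => (2 * G' (‖y‖ ^ 2)) • innerSL ℝ y :=
    funext fun y => (hasFDerivAt_radial (hG _)).fderiv
  have hff := ((hasFDerivAt_radial hG').const_mul 2).smul
    ((innerSL ℝ : E3 →L[ℝ] E3 →L[ℝ] ℝ).hasFDerivAt (x := x))
  rw [hf]
  refine (congrArg norm hff.fderiv).trans_le ((norm_add_le _ _).trans (add_le_add ?_ ?_))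
  · refine ContinuousLinearMap.opNorm_le_bound _ (by positivity) fun v => ?_
    change ‖(2 * G' (‖x‖ ^ 2)) • innerSL ℝ v‖ ≤ _
    rw [norm_smul, innerSL_apply_norm, Real.norm_eq_abs, abs_mul, abs_two]
  · rw [ContinuousLinearMap.norm_smulRight_apply, innerSL_apply_norm, norm_smul, norm_smul,
      innerSL_apply_norm]
    simp only [Real.norm_eq_abs, abs_mul, abs_two]
    exact le_of_eq (by ring)

lemma deriv_profileSlope_eq {a t : ℝ} (ha : 0 < a) (ht : 2 * a < t) :
    deriv (profileSlope a) t = 3 / 4 * invSqrt t ^ 5 := by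
  have h : profileSlope a =ᶠ[𝓝 t] fun s => -(1 / 2) * invSqrt s ^ 3 := by
    filter_upwards [Ioi_mem_nhds ht] with s hs using profileSlope_eq ha (le_of_lt hs)
  have h' := ((hasDerivAt_invSqrt (t := t) (by linarith)).pow 3).const_mul (-(1 / 2))
  rw [h.deriv_eq]
  refine h'.deriv.trans ?_
  norm_num
  ring

/-! ### Integrability and decay for the profile metrics. -/

namespace HasProfile

variable {g : Metric3} {a : ℝ}

lemma scalarCurvature_profile (h : HasProfile g (profile a)) (ha : 0 < a) (x : E3) :
    scalarCurvature g x = -8 * (profile a (‖x‖ ^ 2) ^ 5)⁻¹ *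
      (4 * ‖x‖ ^ 2 * deriv (profileSlope a) (‖x‖ ^ 2) + 6 * profileSlope a (‖x‖ ^ 2)) := by
  rw [h.scalarCurvature_eq, deriv_profile ha]

lemma scalarCurvature_nonneg (h : HasProfile g (profile a)) (ha : 0 < a) (x : E3) :
    0 ≤ scalarCurvature g x := by
  rw [h.scalarCurvature_profile ha]
  have h1 := profile_superharmonic (t := ‖x‖ ^ 2) ha
  have h2 := inv_nonneg.2 (pow_nonneg (h.pos (‖x‖ ^ 2)).le 5)
  nlinarith

lemma integrable_scalarCurvature (h : HasProfile g (profile a)) (ha : 0 < a) :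
    Integrable (scalarCurvature g) (riemannianVolume g) := by
  have hp : Continuous (profile a) := (contDiff_profile ha).continuous
  have hs : Continuous (profileSlope a) := (contDiff_profileSlope ha).continuous
  have hs' : Continuous (deriv (profileSlope a)) :=
    (contDiff_infty_iff_deriv.1 (contDiff_profileSlope ha)).2.continuous
  have hd : Continuous fun x => √(gram g x).det := by
    simp only [h.gram_det]
    fun_prop
  have hc : Continuous (scalarCurvature g) := by
    rw [funext (h.scalarCurvature_profile ha)]
    have : ∀ x : E3, profile a (‖x‖ ^ 2) ^ 5 ≠ 0 := fun x => (pow_pos (h.pos _) 5).ne'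
    fun_prop (disch := assumption)
  rw [riemannianVolume, integrable_withDensity_iff hd.measurable.ennreal_ofReal (by simp)]
  simp only [ENNReal.toReal_ofReal (Real.sqrt_nonneg _)]
  -- The profile is harmonic once `‖x‖² > 2a`, in particular once `‖x‖ > 2a + 1`, so the curvature
  -- has compact support.
  refine (hc.mul hd).integrable_of_hasCompactSupport
    (HasCompactSupport.mul_right (HasCompactSupport.intro
      (isCompact_closedBall (0 : E3) (2 * a + 1)) fun x hx => ?_))
  rw [mem_closedBall_zero_iff, not_le] at hx
  rw [h.scalarCurvature_profile ha, profile_harmonic ha (by nlinarith), mul_zero]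

lemma chartPerturbation_id (h : HasProfile g (profile a)) (i j : Fin 3) :
    chartPerturbation g id i j =
      fun y => (profile a (‖y‖ ^ 2) ^ 4 - 1) * if i = j then 1 else 0 := by
  funext y
  simp only [chartPerturbation, fderiv_id, ContinuousLinearMap.id_apply, id, h.form_eq,
    inner_e3_e3]
  ring

lemma chartPerturbation_isBigO (h : HasProfile g (profile a)) (ha : 0 < a) (i j : Fin 3) :
    (fun y => |chartPerturbation g id i j y|
        + ‖y‖ * ‖fderiv ℝ (chartPerturbation g id i j) y‖
        + ‖y‖ ^ 2 * ‖fderiv ℝ (fderiv ℝ (chartPerturbation g id i j)) y‖)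
      =O[Bornology.cobounded E3] fun y => ‖y‖⁻¹ := by
  rw [h.chartPerturbation_id]
  set c : ℝ := if i = j then 1 else 0 with hc
  have hc0 : 0 ≤ c := by rw [hc]; positivity
  have hc1 : c ≤ 1 := by rw [hc]; split_ifs <;> norm_num
  have hG (t : ℝ) : HasDerivAt (fun s => (profile a s ^ 4 - 1) * c)
      (4 * profile a t ^ 3 * profileSlope a t * c) t := by
    refine ((((hasDerivAt_profile ha t).pow 4).sub_const 1).mul_const c).congr_deriv ?_
    norm_num
  have hG' (t : ℝ) : HasDerivAt (fun s => 4 * profile a s ^ 3 * profileSlope a s * c)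
      ((12 * profile a t ^ 2 * profileSlope a t ^ 2
        + 4 * profile a t ^ 3 * deriv (profileSlope a) t) * c) t := by
    have hs : HasDerivAt (profileSlope a) (deriv (profileSlope a) t) t :=
      ((contDiff_profileSlope ha).differentiable (by simp)).differentiableAt.hasDerivAt
    refine (((((hasDerivAt_profile ha t).pow 3).const_mul 4).mul hs).mul_const c).congr_deriv ?_
    simp only [Pi.pow_apply]
    push_cast
    ring
  -- With `b = G(|y|²)` and `r ≥ 1`, the bounds below are `|G| ≤ 15 r⁻¹`, `|G'| ≤ 16 r⁻³`, `|G''| ≤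
  -- 36 r⁻⁵`. The constant is `15 + 2·16 + (2·16 + 4·36)`.
  refine Asymptotics.IsBigO.of_bound 223 ?_
  filter_upwards [(Metric.hasBasis_cobounded_compl_closedBall (0 : E3)).mem_of_mem
    (i := 2 * a + 1) trivial] with y hy
  rw [mem_compl_iff, mem_closedBall_zero_iff, not_le] at hy
  have hy1 : 1 < ‖y‖ := by linarith
  have hy2 : 2 * a < ‖y‖ ^ 2 := by nlinarith
  have b1 := norm_fderiv_radial_le (hG (‖y‖ ^ 2))
  have b2 := norm_fderiv_fderiv_radial_le hG (hG' (‖y‖ ^ 2))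
  rw [profileSlope_eq ha hy2.le, profile_eq ha hy2.le] at b1 b2
  rw [deriv_profileSlope_eq ha hy2] at b2
  rw [profile_eq ha hy2.le]
  rw [invSqrt_norm_sq] at b1 b2 ⊢
  set r := ‖y‖
  have hr0 : 0 < r := by linarith
  have hrq : r * r⁻¹ = 1 := mul_inv_cancel₀ hr0.ne'
  have hq0 : 0 ≤ r⁻¹ := by positivity
  have hq1 : r⁻¹ ≤ 1 := inv_le_one_of_one_le₀ hy1.le
  have hfac : (1 + r⁻¹) ^ 3 ≤ 8 := by
    calc (1 + r⁻¹) ^ 3 ≤ (1 + 1) ^ 3 := by gcongr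
      _ = 8 := by norm_num
  have hfac2 : (1 + r⁻¹) ^ 2 ≤ 4 := by
    calc (1 + r⁻¹) ^ 2 ≤ (1 + 1) ^ 2 := by gcongr
      _ = 4 := by norm_num
  have c0 : |((1 + r⁻¹) ^ 4 - 1) * c| ≤ 15 * r⁻¹ := by
    have e : (1 + r⁻¹) ^ 4 - 1 = r⁻¹ * (4 + 6 * r⁻¹ + 4 * r⁻¹ ^ 2 + r⁻¹ ^ 3) := by ring
    have e2 : 4 + 6 * r⁻¹ + 4 * r⁻¹ ^ 2 + r⁻¹ ^ 3 ≤ 15 := by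
      have := pow_le_one₀ (n := 2) hq0 hq1
      have := pow_le_one₀ (n := 3) hq0 hq1
      linarith
    rw [e, abs_of_nonneg (by positivity)]
    calc r⁻¹ * (4 + 6 * r⁻¹ + 4 * r⁻¹ ^ 2 + r⁻¹ ^ 3) * c ≤ r⁻¹ * 15 * 1 := by gcongr
      _ = 15 * r⁻¹ := by ring
  have c1 : |4 * (1 + r⁻¹) ^ 3 * (-(1 / 2) * r⁻¹ ^ 3) * c| ≤ 16 * r⁻¹ ^ 3 := by
    rw [show 4 * (1 + r⁻¹) ^ 3 * (-(1 / 2) * r⁻¹ ^ 3) * c = -(2 * (1 + r⁻¹) ^ 3 * r⁻¹ ^ 3 * c) by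
      ring, abs_neg, abs_of_nonneg (by positivity)]
    calc 2 * (1 + r⁻¹) ^ 3 * r⁻¹ ^ 3 * c ≤ 2 * 8 * r⁻¹ ^ 3 * 1 := by gcongr
      _ = 16 * r⁻¹ ^ 3 := by ring
  have c2 : |(12 * (1 + r⁻¹) ^ 2 * (-(1 / 2) * r⁻¹ ^ 3) ^ 2
      + 4 * (1 + r⁻¹) ^ 3 * (3 / 4 * r⁻¹ ^ 5)) * c| ≤ 36 * r⁻¹ ^ 5 := by
    rw [show (12 * (1 + r⁻¹) ^ 2 * (-(1 / 2) * r⁻¹ ^ 3) ^ 2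
      + 4 * (1 + r⁻¹) ^ 3 * (3 / 4 * r⁻¹ ^ 5)) * c
      = (3 * (1 + r⁻¹) ^ 2 * r⁻¹ + 3 * (1 + r⁻¹) ^ 3) * r⁻¹ ^ 5 * c by ring,
      abs_of_nonneg (by positivity)]
    calc (3 * (1 + r⁻¹) ^ 2 * r⁻¹ + 3 * (1 + r⁻¹) ^ 3) * r⁻¹ ^ 5 * c
        ≤ (3 * 4 * 1 + 3 * 8) * r⁻¹ ^ 5 * 1 := by gcongr
      _ = 36 * r⁻¹ ^ 5 := by ring
  rw [Real.norm_of_nonneg (by positivity), Real.norm_of_nonneg hq0]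
  calc _ ≤ 15 * r⁻¹ + r * (2 * (16 * r⁻¹ ^ 3) * r)
        + r ^ 2 * (2 * (16 * r⁻¹ ^ 3) + 4 * (36 * r⁻¹ ^ 5) * r ^ 2) := by
        gcongr
        · exact b1.trans (by gcongr)
        · exact b2.trans (by gcongr)
    _ = 223 * r⁻¹ := by
        field_simp
        norm_num

lemma isAsymptoticallyFlat (h : HasProfile g (profile a)) (ha : 0 < a) :
    IsAsymptoticallyFlat g where
  complete := h.isCompleteMetric (fun t => (one_lt_profile ha t).le)
    fun _ ht => antitone_profile ha ht
  scalar_nonneg := h.scalarCurvature_nonneg ha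
  scalar_integrable := h.integrable_scalarCurvature ha
  -- The chart at infinity is the identity; the radius of the removed ball is immaterial.
  end_flat := ⟨Metric.closedBall 0 1, 1,
    OpenPartialHomeomorph.ofSet _ Metric.isClosed_closedBall.isOpen_compl,
    isCompact_closedBall _ _, one_pos, rfl, rfl, contDiffOn_id, contDiffOn_id,
    h.chartPerturbation_isBigO ha⟩

lemma isRadialConformal (h : HasProfile g (profile a)) (ha : 0 < a) :
    IsRadialConformal g fun x => profile a (‖x‖ ^ 2) where
  smooth := (contDiff_profile ha).comp (contDiff_norm_sq ℝ)
  pos _ := profile_pos ha _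
  radial x y hxy := by simp only [hxy]
  superharmonic x := by
    rw [laplacian_radial (contDiff_profile ha), deriv_profile ha]
    exact profile_superharmonic ha
  conformal := h.form_eq

end HasProfile

/-! ### Surfaces in a rotationally symmetric conformally flat metric -/

lemma inner_eq_sum (v w : E3) : inner ℝ v w = v 0 * w 0 + v 1 * w 1 + v 2 * w 2 := by
  rw [PiLp.inner_apply, Fin.sum_univ_three]
  simp
  ring

/-- A vector of `ℝ³` orthogonal to `v`, `w` and to a nonzero normal vector `x` of the plane spanned
by `v` and `w` vanishes. -/
lemma eq_zero_of_orthogonal {v w x n : E3}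
    (hvw : 0 < inner ℝ v v * inner ℝ w w - inner ℝ v w ^ 2) (hx : x ≠ 0)
    (hxv : inner ℝ x v = 0) (hxw : inner ℝ x w = 0)
    (hnv : inner ℝ n v = 0) (hnw : inner ℝ n w = 0) (hnx : inner ℝ n x = 0) : n = 0 := by
  have hxx : 0 < inner ℝ x x := real_inner_self_pos.2 hx
  set A : Matrix (Fin 3) (Fin 3) ℝ := !![v 0, v 1, v 2; w 0, w 1, w 2; x 0, x 1, x 2] with hA
  have hdet : A.det ≠ 0 := by
    -- The square of the determinant is the Gram determinant of `v`, `w`, `x`, which is block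
    -- diagonal because `x` is normal to the plane.
    have h : A.det ^ 2 = inner ℝ x x * (inner ℝ v v * inner ℝ w w - inner ℝ v w ^ 2) := by
      have e : A.det ^ 2 = inner ℝ x x * (inner ℝ v v * inner ℝ w w - inner ℝ v w ^ 2)
          - inner ℝ x w * (inner ℝ v v * inner ℝ x w - inner ℝ v w * inner ℝ x v)
          + inner ℝ x v * (inner ℝ v w * inner ℝ x w - inner ℝ w w * inner ℝ x v) := by
        rw [hA, Matrix.det_fin_three]
        simp only [inner_eq_sum]
        simp
        ring
      rw [e, hxv, hxw]
      ring
    intro h0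
    rw [h0] at h
    have := mul_pos hxx hvw
    rw [← h] at this
    norm_num at this
  have hmul : A.mulVec n = 0 := by
    rw [inner_eq_sum] at hnv hnw hnx
    ext i
    fin_cases i <;> simp [hA, Matrix.mulVec, dotProduct, Fin.sum_univ_three] <;> linarith
  ext i
  exact congrFun (Matrix.eq_zero_of_mulVec_eq_zero hdet hmul) i

/-- The determinant of the Euclidean first fundamental form. -/
def flatDet (X : E2 → E3) (y : E2) : ℝ :=
  inner ℝ (tangentVec X 0 y) (tangentVec X 0 y) * inner ℝ (tangentVec X 1 y) (tangentVec X 1 y)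
    - inner ℝ (tangentVec X 0 y) (tangentVec X 1 y) ^ 2

lemma flatDet_pos {X : E2 → E3} {y : E2} (hX : Function.Injective (fderiv ℝ X y)) :
    0 < flatDet X y := by
  have h2 : ∀ c : E2, c ≠ 0 → fderiv ℝ X y c ≠ 0 := fun c hc h =>
    hc (hX (h.trans (map_zero _).symm))
  have h0 : 0 < inner ℝ (tangentVec X 0 y) (tangentVec X 0 y) := by
    refine real_inner_self_pos.2 (h2 _ fun h => ?_)
    simpa [e2] using congrArg (fun z : E2 => z 0) h
  -- An unnormalised Gram–Schmidt vector: its squared length is `|X_0|²` times `flatDet`.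
  have h1 : inner ℝ (tangentVec X 0 y) (tangentVec X 0 y) • tangentVec X 1 y
      - inner ℝ (tangentVec X 0 y) (tangentVec X 1 y) • tangentVec X 0 y ≠ 0 := by
    have := h2 (inner ℝ (tangentVec X 0 y) (tangentVec X 0 y) • e2 1
      - inner ℝ (tangentVec X 0 y) (tangentVec X 1 y) • e2 0) fun h => by
        have := congrArg (fun z : E2 => z 1) h
        simp [e2] at this
        exact h0.ne' (by simp [this])
    rwa [map_sub, map_smul, map_smul] at this
  have h3 := real_inner_self_pos.2 h1
  have h4 : inner ℝ (tangentVec X 0 y) (tangentVec X 0 y) * flatDet X y = inner ℝ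
      (inner ℝ (tangentVec X 0 y) (tangentVec X 0 y) • tangentVec X 1 y
        - inner ℝ (tangentVec X 0 y) (tangentVec X 1 y) • tangentVec X 0 y)
      (inner ℝ (tangentVec X 0 y) (tangentVec X 0 y) • tangentVec X 1 y
        - inner ℝ (tangentVec X 0 y) (tangentVec X 1 y) • tangentVec X 0 y) := by
    simp only [inner_sub_left, inner_sub_right, real_inner_smul_left, real_inner_smul_right,
      real_inner_comm (tangentVec X 0 y) (tangentVec X 1 y), flatDet]
    ring
  rw [← h4] at h3
  exact pos_of_mul_pos_right h3 h0.le

/-- The second derivatives of `|X|²`. -/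
lemma fderiv_fderiv_inner_self {X : E2 → E3} {y : E2} (hX : ContDiffAt ℝ 2 X y) (a b : Fin 2) :
    fderiv ℝ (fderiv ℝ fun z => inner ℝ (X z) (X z)) y (e2 a) (e2 b) =
      2 * (inner ℝ (tangentVec X a y) (tangentVec X b y)
        + inner ℝ (X y) (fderiv ℝ (tangentVec X b) y (e2 a))) := by
  have hd : ∀ᶠ z in 𝓝 y, DifferentiableAt ℝ X z := by
    filter_upwards [hX.eventually (by simp)] with z hz using hz.differentiableAt (by simp)
  have hφ : ContDiffAt ℝ 2 (fun z => inner ℝ (X z) (X z)) y := hX.inner ℝ hX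
  have hφ' : DifferentiableAt ℝ (fderiv ℝ fun z => inner ℝ (X z) (X z)) y :=
    (hφ.fderiv_right (m := 1) (by norm_num)).differentiableAt (by simp)
  have hT : DifferentiableAt ℝ (tangentVec X b) y :=
    ((hX.fderiv_right (m := 1) (by norm_num)).differentiableAt (by simp)).clm_apply
      (differentiableAt_const _)
  have e1 : fderiv ℝ (fderiv ℝ fun z => inner ℝ (X z) (X z)) y (e2 a) (e2 b)
      = fderiv ℝ (fun z => fderiv ℝ (fun z => inner ℝ (X z) (X z)) z (e2 b)) y (e2 a) := by
    rw [fderiv_clm_apply hφ' (differentiableAt_const _)]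
    simp
  have e2' : (fun z => fderiv ℝ (fun z => inner ℝ (X z) (X z)) z (e2 b))
      =ᶠ[𝓝 y] fun z => 2 * inner ℝ (X z) (tangentVec X b z) := by
    filter_upwards [hd] with z hz
    rw [fderiv_inner_apply ℝ hz hz, tangentVec, real_inner_comm (X z)]
    ring
  rw [e1, e2'.fderiv_eq, fderiv_const_mul (hd.self_of_nhds.inner ℝ hT), smul_apply,
    fderiv_inner_apply ℝ hd.self_of_nhds hT, smul_eq_mul, add_comm, tangentVec]
  rfl

lemma fderiv_inner_self {X : E2 → E3} {y : E2} (hX : ContDiffAt ℝ 2 X y) (a : Fin 2) :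
    fderiv ℝ (fun z => inner ℝ (X z) (X z)) y (e2 a) = 2 * inner ℝ (X y) (tangentVec X a y) := by
  have := hX.differentiableAt (by simp)
  rw [fderiv_inner_apply ℝ this this, tangentVec, real_inner_comm (X y)]
  ring

/-- The second derivative test: the Hessian is nonpositive at a local maximum. -/
lemma fderiv_fderiv_nonpos_of_isLocalMax {E : Type*} [NormedAddCommGroup E] [NormedSpace ℝ E]
    {φ : E → ℝ} {x : E} (hφ : ContDiffAt ℝ 2 φ x) (h : IsLocalMax φ x) (v : E) :
    fderiv ℝ (fderiv ℝ φ) x v v ≤ 0 := by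
  set l : ℝ → E := fun s => x + s • v with hl
  have hl0 : l 0 = x := by simp [hl]
  have hld (s : ℝ) : HasDerivAt l v s :=
    (((hasDerivAt_id s).smul_const v).const_add x).congr_deriv (one_smul _ _)
  have hlc : Tendsto l (𝓝 0) (𝓝 x) := by simpa [hl0] using (hld 0).continuousAt.tendsto
  have hd : ∀ᶠ z in 𝓝 x, DifferentiableAt ℝ φ z := by
    filter_upwards [hφ.eventually (by simp)] with z hz using hz.differentiableAt (by simp)
  have h1 : deriv (φ ∘ l) =ᶠ[𝓝 0] fun s => fderiv ℝ φ (l s) v := by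
    filter_upwards [hlc.eventually hd] with s hs
    exact (hs.hasFDerivAt.comp_hasDerivAt s (hld s)).deriv
  have h2 : deriv (deriv (φ ∘ l)) 0 = fderiv ℝ (fderiv ℝ φ) x v v := by
    have hφ' : HasFDerivAt (fderiv ℝ φ) (fderiv ℝ (fderiv ℝ φ) x) (l 0) := by
      rw [hl0]
      exact ((hφ.fderiv_right (m := 1) (by norm_num)).differentiableAt (by simp)).hasFDerivAt
    rw [h1.deriv_eq]
    simpa using ((hφ'.comp_hasDerivAt 0 (hld 0)).clm_apply (hasDerivAt_const 0 v)).deriv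
  have hmax : IsLocalMax (φ ∘ l) 0 := by
    have : ∀ᶠ z in 𝓝 x, φ z ≤ φ x := h
    filter_upwards [hlc.eventually this] with s hs
    simpa [hl0] using hs
  by_contra! hpos
  rw [← h2] at hpos
  have hc : ContinuousAt (φ ∘ l) 0 := by
    refine ContinuousAt.comp ?_ (hld 0).continuousAt
    rw [hl0]
    exact hφ.continuousAt
  -- A positive second derivative would make `0` a local minimum too, hence `φ ∘ l` locally
  -- constant, which forces that derivative to vanish.
  have hmin := isLocalMin_of_deriv_deriv_pos hpos hmax.deriv_eq_zero hc
  have hconst : φ ∘ l =ᶠ[𝓝 0] fun _ => (φ ∘ l) 0 := by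
    filter_upwards [hmax, hmin] with s h1 h2 using le_antisymm h1 h2
  rw [hconst.deriv.deriv_eq] at hpos
  simp at hpos

/-! ### Extrinsic geometry of surfaces in `F(|x|²)⁴ δ`. -/

namespace HasProfile

variable {g : Metric3} {F : ℝ → ℝ}

lemma christoffel_contract (h : HasProfile g F) (x v w : E3) :
    ∑ k, (∑ i, ∑ j, christoffel g k i j x * v i * w j) • e3 k =
      christoffelCoeff F (‖x‖ ^ 2) •
        (inner ℝ x v • w + inner ℝ x w • v - inner ℝ v w • x) := by
  ext k
  simp only [h.christoffel_eq, inner_eq_sum, e3]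
  fin_cases k <;> simp [Fin.sum_univ_three] <;> ring

lemma covDeriv_eq (h : HasProfile g F) (X : E2 → E3) (a b : Fin 2) (y : E2) :
    covDeriv g X a b y = fderiv ℝ (tangentVec X b) y (e2 a) + christoffelCoeff F (‖X y‖ ^ 2) •
      (inner ℝ (X y) (tangentVec X a y) • tangentVec X b y
        + inner ℝ (X y) (tangentVec X b y) • tangentVec X a y
        - inner ℝ (tangentVec X a y) (tangentVec X b y) • X y) := by
  rw [covDeriv, h.christoffel_contract]

lemma firstForm_apply (h : HasProfile g F) (X : E2 → E3) (y : E2) (a b : Fin 2) :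
    firstForm g X y a b
      = F (‖X y‖ ^ 2) ^ 4 * inner ℝ (tangentVec X a y) (tangentVec X b y) := by
  simp [firstForm, h.form_eq]

lemma firstForm_inv (h : HasProfile g F) (X : E2 → E3) (y : E2) :
    (firstForm g X y)⁻¹ = ((F (‖X y‖ ^ 2) ^ 4)⁻¹ * (flatDet X y)⁻¹) •
      !![inner ℝ (tangentVec X 1 y) (tangentVec X 1 y),
        -inner ℝ (tangentVec X 0 y) (tangentVec X 1 y);
        -inner ℝ (tangentVec X 0 y) (tangentVec X 1 y),
        inner ℝ (tangentVec X 0 y) (tangentVec X 0 y)] := by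
  have h0 : F (‖X y‖ ^ 2) ≠ 0 := (h.pos _).ne'
  have hdet : (firstForm g X y).det = F (‖X y‖ ^ 2) ^ 8 * flatDet X y := by
    rw [Matrix.det_fin_two]
    simp only [h.firstForm_apply, flatDet, real_inner_comm (tangentVec X 0 y) (tangentVec X 1 y)]
    ring
  rw [Matrix.inv_def, Ring.inverse_eq_inv', hdet, Matrix.adjugate_fin_two]
  simp only [h.firstForm_apply, real_inner_comm (tangentVec X 0 y) (tangentVec X 1 y)]
  ext i j
  rcases eq_or_ne (flatDet X y) 0 with hD | hD
  -- In the degenerate case both inverses are zero by convention.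
  · simp [hD]
  · fin_cases i <;> fin_cases j <;> simp <;> field_simp

lemma inner_normalPart_of_orthogonal (g : Metric3) {X : E2 → E3} {y : E2} {n : E3}
    (hn : ∀ a, inner ℝ (tangentVec X a y) n = 0) (v : E3) :
    inner ℝ (normalPart g X y v) n = inner ℝ v n := by
  simp [normalPart, inner_sub_left, inner_add_left, real_inner_smul_left, hn]

lemma inner_normalPart_tangentVec (h : HasProfile g F) {X : E2 → E3} {y : E2}
    (hD : flatDet X y ≠ 0) (v : E3) (c : Fin 2) :
    inner ℝ (normalPart g X y v) (tangentVec X c y) = 0 := by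
  have h0 : F (‖X y‖ ^ 2) ≠ 0 := (h.pos _).ne'
  simp only [normalPart, inner_sub_left, Fin.sum_univ_two, inner_add_left, real_inner_smul_left,
    h.form_eq, h.firstForm_inv]
  fin_cases c <;> simp [real_inner_comm (tangentVec X 0 y) (tangentVec X 1 y)] <;> field_simp <;>
    simp only [flatDet, real_inner_self_eq_norm_sq] <;> ring

/-- The adjugate formula for the inverse turns `|∇ψ|²` into a positive multiple of `|ψ_0 X_1 - ψ_1
X_0|²`. -/
lemma gradNormSq_nonneg (h : HasProfile g F) {X : E2 → E3} {y : E2} (hD : 0 < flatDet X y)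
    (ψ : E2 → ℝ) : 0 ≤ gradNormSq g X ψ y := by
  have h0 := h.pos (‖X y‖ ^ 2)
  have e : gradNormSq g X ψ y = (F (‖X y‖ ^ 2) ^ 4)⁻¹ * (flatDet X y)⁻¹ *
      inner ℝ (fderiv ℝ ψ y (e2 0) • tangentVec X 1 y - fderiv ℝ ψ y (e2 1) • tangentVec X 0 y)
        (fderiv ℝ ψ y (e2 0) • tangentVec X 1 y - fderiv ℝ ψ y (e2 1) • tangentVec X 0 y) := by
    simp only [gradNormSq, h.firstForm_inv, Fin.sum_univ_two, inner_sub_left, inner_sub_right,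
      real_inner_smul_left, real_inner_smul_right]
    simp [real_inner_comm (tangentVec X 0 y) (tangentVec X 1 y)]
    ring
  rw [e]
  exact mul_nonneg (by positivity) real_inner_self_nonneg

/-- Where the position vector is normal to the surface, pairing with it removes the tangential
corrections and leaves one Christoffel term. This covers the point of the surface farthest from the
origin. -/
lemma inner_meanCurvatureVec (h : HasProfile g F) {X : E2 → E3} {y : E2}
    (hX : ∀ a, inner ℝ (X y) (tangentVec X a y) = 0) :
    inner ℝ (meanCurvatureVec g X y) (X y) = ∑ a, ∑ b, (firstForm g X y)⁻¹ a b *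
      (inner ℝ (X y) (fderiv ℝ (tangentVec X b) y (e2 a))
        - christoffelCoeff F (‖X y‖ ^ 2) * ‖X y‖ ^ 2 *
          inner ℝ (tangentVec X a y) (tangentVec X b y)) := by
  have hX' (a) : inner ℝ (tangentVec X a y) (X y) = 0 := by rw [real_inner_comm, hX]
  simp only [meanCurvatureVec, sum_inner, real_inner_smul_left, secondForm,
    inner_normalPart_of_orthogonal g hX', h.covDeriv_eq, hX, inner_add_left, inner_sub_left,
    real_inner_self_eq_norm_sq]
  refine Finset.sum_congr rfl fun a _ => Finset.sum_congr rfl fun b _ => ?_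
  rw [real_inner_comm (X y)]
  ring

lemma ricciForm_radial (h : HasProfile g F) (x : E3) (c : ℝ) :
    ricciForm g x (c • x) (c • x) = -4 * c ^ 2 * ‖x‖ ^ 2 *
      (deriv (christoffelCoeff F) (‖x‖ ^ 2) * ‖x‖ ^ 2 + christoffelCoeff F (‖x‖ ^ 2)) := by
  simp only [ricciForm, h.ricci_eq]
  generalize christoffelCoeff F (‖x‖ ^ 2) = L
  generalize deriv (christoffelCoeff F) (‖x‖ ^ 2) = M
  rw [norm_sq_eq_sum]
  simp [Fin.sum_univ_three]
  ring

end HasProfile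

/-! ### Immersed surfaces in charts -/

section Charts

variable {S : Type} [TopologicalSpace S] [ChartedSpace E2 S]

lemma contDiffAt_inChart [IsManifold (𝓡 2) ∞ S] {f : S → E3}
    (hf : ContMDiff (𝓡 2) 𝓘(ℝ, E3) ∞ f) (p : S) :
    ContDiffAt ℝ ∞ (inChart f p) (extChartAt (𝓡 2) p p) := by
  have h : ContDiffOn ℝ ∞ (inChart f p) (extChartAt (𝓡 2) p).target :=
    contMDiffOn_iff_contDiffOn.1 (hf.comp_contMDiffOn (contMDiffOn_extChartAt_symm p))
  exact h.contDiffAt (extChartAt_target_mem_nhds p)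

lemma fderiv_inChart_injective {f : S → E3} (hf : IsSmoothImmersion f) (p : S) :
    Function.Injective (fderiv ℝ (inChart f p) (extChartAt (𝓡 2) p p)) := by
  have h1 := hf.2 p
  rw [((hf.1 p).mdifferentiableAt (by simp)).mfderiv] at h1
  have h2 : fderivWithin ℝ (writtenInExtChartAt (𝓡 2) 𝓘(ℝ, E3) p f) (range (𝓡 2))
      (extChartAt (𝓡 2) p p) = fderiv ℝ (inChart f p) (extChartAt (𝓡 2) p p) := by
    rw [ModelWithCorners.range_eq_univ, fderivWithin_univ]
    rfl
  rw [← h2]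
  exact h1

lemma inChart_apply_self {V : Type} (f : S → V) (p : S) :
    inChart f p (extChartAt (𝓡 2) p p) = f p := by
  simp only [inChart, Function.comp_apply, extChartAt_to_inv]

lemma flatDet_inChart_pos {f : S → E3} (hf : IsSmoothImmersion f) (p : S) :
    0 < flatDet (inChart f p) (extChartAt (𝓡 2) p p) :=
  flatDet_pos (fderiv_inChart_injective hf p)

lemma areaDensity_nonneg (g : Metric3) (X : E2 → E3) (y : E2) : 0 ≤ areaDensity g X y :=
  Real.sqrt_nonneg _

/-- No integrability is needed: pointwise nonnegativity passes through the integral and the finite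
sum even at their default values. -/
lemma surfaceIntegral_nonneg [IsManifold (𝓡 2) ∞ S] [T2Space S] [SigmaCompactSpace S]
    (g : Metric3) (f : S → E3) {Q : S → ℝ} (hQ : ∀ p, 0 ≤ Q p) : 0 ≤ surfaceIntegral g f Q :=
  finsum_nonneg fun p => integral_nonneg fun _ =>
    mul_nonneg (mul_nonneg ((chartPartition S).nonneg p _) (hQ _)) (areaDensity_nonneg _ _ _)

/-- If all coordinate spheres are strictly mean convex, then there is no compact minimal surface:
compare with the smallest coordinate sphere that encloses the surface. -/
lemma HasProfile.not_isMinimal [IsManifold (𝓡 2) ∞ S] [CompactSpace S] [Nonempty S]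
    {g : Metric3} {F : ℝ → ℝ} (h : HasProfile g F) (hF : ∀ t, 0 < F t + 4 * t * deriv F t)
    {f : S → E3} (hf : IsSmoothImmersion f) : ¬ IsMinimal g f := by
  intro hmin
  obtain ⟨p, -, hp⟩ := isCompact_univ.exists_isMaxOn univ_nonempty
    (hf.1.continuous.inner hf.1.continuous (𝕜 := ℝ)).continuousOn
  have hD := flatDet_inChart_pos hf p
  have hX : ContDiffAt ℝ 2 (inChart f p) (extChartAt (𝓡 2) p p) :=
    (contDiffAt_inChart hf.1 p).of_le ENat.LEInfty.out
  have hmax : IsLocalMax (fun z => inner ℝ (inChart f p z) (inChart f p z))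
      (extChartAt (𝓡 2) p p) := by
    refine Eventually.of_forall fun z => ?_
    simp only [inChart_apply_self]
    exact hp (mem_univ _)
  have hmean := hmin p
  set X := inChart f p
  set y := extChartAt (𝓡 2) p p
  have hperp (a) : inner ℝ (X y) (tangentVec X a y) = 0 := by
    have := fderiv_inner_self hX a
    rw [hmax.fderiv_eq_zero] at this
    simpa using this.symm
  have hM := h.inner_meanCurvatureVec hperp
  rw [hmean, inner_zero_left, h.firstForm_inv] at hM
  have hess := fderiv_fderiv_nonpos_of_isLocalMax (hX.inner ℝ hX) hmax
  have hess0 := hess (e2 0)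
  -- The directions `e2 0` and `-B e2 0 + A e2 1` are orthogonal for the Euclidean first fundamental
  -- form with entries `A`, `B`, `C`. The Hessian on them, the first value weighted by `AC - B²`,
  -- sums to a positive multiple of its trace.
  have hess1 := hess ((-inner ℝ (tangentVec X 0 y) (tangentVec X 1 y)) • e2 0
    + inner ℝ (tangentVec X 0 y) (tangentVec X 0 y) • e2 1)
  have h00 : 0 < inner ℝ (tangentVec X 0 y) (tangentVec X 0 y) := by
    have h0 : 0 ≤ inner ℝ (tangentVec X 0 y) (tangentVec X 0 y) := real_inner_self_nonneg
    refine h0.lt_of_ne fun h0 => ?_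
    rw [flatDet, ← h0] at hD
    nlinarith [sq_nonneg (inner ℝ (tangentVec X 0 y) (tangentVec X 1 y))]
  have hw : 0 < 1 + christoffelCoeff F (‖X y‖ ^ 2) * ‖X y‖ ^ 2 := by
    have h1 := h.pos (‖X y‖ ^ 2)
    have h2 := div_pos (hF (‖X y‖ ^ 2)) h1
    have h3 : 1 + christoffelCoeff F (‖X y‖ ^ 2) * ‖X y‖ ^ 2
      = (F (‖X y‖ ^ 2) + 4 * ‖X y‖ ^ 2 * deriv F (‖X y‖ ^ 2)) / F (‖X y‖ ^ 2) := by
      rw [christoffelCoeff]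
      field_simp
    rwa [h3]
  have hk : 0 < (F (‖X y‖ ^ 2) ^ 4)⁻¹ * (flatDet X y)⁻¹ :=
    mul_pos (inv_pos.2 (pow_pos (h.pos _) 4)) (inv_pos.2 hD)
  simp only [map_add, map_smul, add_apply, smul_apply, fderiv_fderiv_inner_self hX,
    smul_eq_mul] at hess0 hess1
  simp only [Fin.sum_univ_two, Matrix.smul_apply, Matrix.of_apply, Matrix.cons_val',
    Matrix.cons_val_zero, Matrix.cons_val_one, Matrix.cons_val_fin_one, smul_eq_mul] at hM
  rw [real_inner_comm (tangentVec X 0 y) (tangentVec X 1 y)] at hess1 hM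
  rw [flatDet] at hD hM hk
  generalize inner ℝ (tangentVec X 0 y) (tangentVec X 0 y) = A at *
  generalize inner ℝ (tangentVec X 0 y) (tangentVec X 1 y) = B at *
  generalize inner ℝ (tangentVec X 1 y) (tangentVec X 1 y) = C at *
  generalize inner ℝ (X y) (fderiv ℝ (tangentVec X 0) y (e2 0)) = m00 at *
  generalize inner ℝ (X y) (fderiv ℝ (tangentVec X 1) y (e2 0)) = m01 at *
  generalize inner ℝ (X y) (fderiv ℝ (tangentVec X 0) y (e2 1)) = m10 at *
  generalize inner ℝ (X y) (fderiv ℝ (tangentVec X 1) y (e2 1)) = m11 at *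
  generalize christoffelCoeff F (‖X y‖ ^ 2) * ‖X y‖ ^ 2 = l at *
  generalize (F (‖X y‖ ^ 2) ^ 4)⁻¹ * (A * C - B ^ 2)⁻¹ = k at *
  have hM' : C * (m00 - l * A) - B * (m01 - l * B) - B * (m10 - l * B) + A * (m11 - l * C) = 0 := by
    refine (mul_eq_zero.1 (?_ : k * _ = 0)).resolve_left hk.ne'
    rw [hM]
    ring
  -- Minimality fixes the trace of the `m` terms as `2l(AC - B²)`, so the weighted Hessian
  -- inequalities would make this quantity nonpositive.
  have hlow : 0 < 2 * A * ((1 + l) * (A * C - B ^ 2)) := by positivity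
  have hess0' : (A * C - B ^ 2) * (A + m00) ≤ 0 :=
    mul_nonpos_of_nonneg_of_nonpos hD.le (by linarith)
  have key : A * (C * (m00 - l * A) - B * (m01 - l * B) - B * (m10 - l * B)
      + A * (m11 - l * C)) = 0 := by
    rw [hM', mul_zero]
  nlinarith

end Charts

/-! ### The horizon -/

lemma isSmoothImmersion_coe_sphere :
    IsSmoothImmersion ((↑) : Metric.sphere (0 : E3) 1 → E3) :=
  ⟨contMDiff_coe_sphere, fun p => injective_mvfderiv_subtypeVal_sphere p⟩

lemma inner_inChart_coe_sphere (p : Metric.sphere (0 : E3) 1) :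
    (fun z => inner ℝ (inChart ((↑) : Metric.sphere (0 : E3) 1 → E3) p z)
      (inChart ((↑) : Metric.sphere (0 : E3) 1 → E3) p z)) = fun _ => 1 := by
  funext z
  simp [inChart]

lemma inner_coe_sphere_tangentVec (p : Metric.sphere (0 : E3) 1) (a : Fin 2) :
    inner ℝ (p : E3) (tangentVec (inChart (↑) p) a (extChartAt (𝓡 2) p p)) = 0 := by
  have h := fderiv_inner_self (((contDiffAt_inChart isSmoothImmersion_coe_sphere.1 p).of_le
    ENat.LEInfty.out)) a
  rw [inner_inChart_coe_sphere, inChart_apply_self, fderiv_const_apply, zero_apply] at h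
  linarith

namespace HasProfile

variable {g : Metric3} {F : ℝ → ℝ}

/-- If `F + 4 F' = 0` at `1`, then the unit sphere is totally geodesic. -/
lemma secondForm_coe_sphere (h : HasProfile g F) (hF : F 1 + 4 * deriv F 1 = 0)
    (p : Metric.sphere (0 : E3) 1) (a b : Fin 2) :
    secondForm g (inChart (↑) p) a b (extChartAt (𝓡 2) p p) = 0 := by
  have hf := isSmoothImmersion_coe_sphere
  have hD := flatDet_inChart_pos hf p
  have hX : ContDiffAt ℝ 2 (inChart ((↑) : Metric.sphere (0 : E3) 1 → E3) p)
      (extChartAt (𝓡 2) p p) := (contDiffAt_inChart hf.1 p).of_le ENat.LEInfty.out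
  have hn (z) : ‖inChart ((↑) : Metric.sphere (0 : E3) 1 → E3) p z‖ = 1 := by simp [inChart]
  have hc := inner_inChart_coe_sphere p
  have hperp := inner_coe_sphere_tangentVec p
  rw [← inChart_apply_self ((↑) : Metric.sphere (0 : E3) 1 → E3) p] at hperp
  rw [secondForm]
  set X := inChart ((↑) : Metric.sphere (0 : E3) 1 → E3) p
  set y := extChartAt (𝓡 2) p p
  have hperp' (a) : inner ℝ (tangentVec X a y) (X y) = 0 := by rw [real_inner_comm, hperp]
  -- Differentiate `|X|² = 1` twice.
  have hess : inner ℝ (X y) (fderiv ℝ (tangentVec X b) y (e2 a))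
      = -inner ℝ (tangentVec X a y) (tangentVec X b y) := by
    have := fderiv_fderiv_inner_self hX a b
    rw [hc] at this
    simp at this
    linarith
  have hL : christoffelCoeff F 1 = -1 := by
    have := (h.pos 1).ne'
    rw [christoffelCoeff]
    field_simp
    linarith
  have hx : X y ≠ 0 := norm_ne_zero_iff.1 (by rw [hn]; exact one_ne_zero)
  refine eq_zero_of_orthogonal hD hx (hperp 0) (hperp 1)
    (h.inner_normalPart_tangentVec hD.ne' _ 0) (h.inner_normalPart_tangentVec hD.ne' _ 1) ?_
  -- The Euclidean term contributes `-⟨X_a, X_b⟩` and the Christoffel term, with coefficient `-1`,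
  -- contributes the opposite.
  rw [inner_normalPart_of_orthogonal g hperp', h.covDeriv_eq, hn, one_pow, hL]
  simp only [hperp, zero_smul, zero_add, zero_sub, inner_add_left, inner_neg_left,
    real_inner_smul_left, real_inner_self_eq_norm_sq, hn]
  rw [real_inner_comm, hess]
  ring

/-- With `|A|² = 0`, stability reduces to the sign of `Ric(ν, ν)`, which is `-4 F(1)⁻⁴` times the
derivative of `christoffelCoeff F` at `1` minus `1`. The second hypothesis makes it nonpositive. -/
lemma containsStableMinimalSphere (h : HasProfile g F) (hF : F 1 + 4 * deriv F 1 = 0)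
    (hL : 1 ≤ deriv (christoffelCoeff F) 1) : ContainsStableMinimalSphere g := by
  have hf := isSmoothImmersion_coe_sphere
  have hL' : christoffelCoeff F 1 = -1 := by
    have := (h.pos 1).ne'
    rw [christoffelCoeff]
    field_simp
    linarith
  have hF0 := h.pos 1
  refine ⟨(↑), IsEmbedding.subtypeVal, hf, fun p => ?_,
    fun p => (F 1 ^ 2)⁻¹ • (p : E3), ⟨?_, fun p => ?_, fun p a => ?_⟩, fun φ _ => ?_⟩
  · simp only [meanCurvatureVec, h.secondForm_coe_sphere hF, smul_zero, Finset.sum_const_zero]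
  · exact (contDiff_const_smul (F 1 ^ 2)⁻¹).contMDiff.comp contMDiff_coe_sphere
  · rw [h.form_eq, real_inner_smul_left, real_inner_smul_right, real_inner_self_eq_norm_sq,
      norm_eq_of_mem_sphere, one_pow]
    field_simp
  · rw [h.form_eq, real_inner_smul_left, inner_coe_sphere_tangentVec, mul_zero, mul_zero]
  · refine surfaceIntegral_nonneg g _ fun p => ?_
    have h1 := h.gradNormSq_nonneg (flatDet_inChart_pos hf p) (inChart φ p)
    have h2 : secondFormNormSq g (inChart (↑) p) (extChartAt (𝓡 2) p p) = 0 := by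
      simp only [secondFormNormSq, h.secondForm_coe_sphere hF, h.form_eq, inner_zero_left, mul_zero,
        Finset.sum_const_zero]
    have h3 : ricciForm g p ((F 1 ^ 2)⁻¹ • (p : E3)) ((F 1 ^ 2)⁻¹ • (p : E3)) ≤ 0 := by
      rw [h.ricciForm_radial, norm_eq_of_mem_sphere, one_pow, hL']
      nlinarith [sq_nonneg ((F 1 ^ 2)⁻¹)]
    rw [stabilityIntegrand, h2, add_zero]
    nlinarith [sq_nonneg (φ p)]

end HasProfile

end MinimalSurfaceR3

end

/-! ### The two choices of the parameter. -/

theorem mainTheorem9 :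
    ∃ (g₁ g₂ : MinimalSurfaceR3.Metric3) (u₁ u₂ : MinimalSurfaceR3.E3 → ℝ),
      MinimalSurfaceR3.IsRadialConformal g₁ u₁ ∧
      MinimalSurfaceR3.IsRadialConformal g₂ u₂ ∧
      MinimalSurfaceR3.IsAsymptoticallyFlat g₁ ∧
      MinimalSurfaceR3.IsAsymptoticallyFlat g₂ ∧
      (∀ x, 0 ≤ MinimalSurfaceR3.scalarCurvature g₁ x) ∧
      (∀ x, 0 ≤ MinimalSurfaceR3.scalarCurvature g₂ x) ∧
      (∃ K : Set MinimalSurfaceR3.E3, IsCompact K ∧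
        ∀ x, x ∉ K → ∀ v w, MinimalSurfaceR3.form g₁ x v w = MinimalSurfaceR3.form g₂ x v w) ∧
      MinimalSurfaceR3.ContainsStableMinimalSphere g₁ ∧
      ¬ MinimalSurfaceR3.ContainsCompactMinimalSurface g₂ := by
  open MinimalSurfaceR3 in
  -- For `a = 1/4` the exact Schwarzschild region `|x|² ≥ 1/2` contains a neighbourhood of the
  -- horizon. The value `a = 4` meets the bound for strict mean convexity.
  have ha₁ : (0 : ℝ) < 1 / 4 := by norm_num
  have ha₂ : (0 : ℝ) < 4 := by norm_num
  obtain ⟨g₁, h₁⟩ := exists_hasProfile (contDiff_profile ha₁) (profile_pos ha₁)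
  obtain ⟨g₂, h₂⟩ := exists_hasProfile (contDiff_profile ha₂) (profile_pos ha₂)
  refine ⟨g₁, g₂, _, _, h₁.isRadialConformal ha₁, h₂.isRadialConformal ha₂,
    h₁.isAsymptoticallyFlat ha₁, h₂.isAsymptoticallyFlat ha₂, h₁.scalarCurvature_nonneg ha₁,
    h₂.scalarCurvature_nonneg ha₂, ⟨Metric.closedBall 0 3, isCompact_closedBall _ _, ?_⟩, ?_, ?_⟩
  -- Both profiles are explicit for `|x|² ≥ 8`, and `3² > 8`.
  · intro x hx v w
    rw [mem_closedBall_zero_iff, not_le] at hx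
    rw [h₁.form_eq, h₂.form_eq, profile_eq ha₁ (by nlinarith), profile_eq ha₂ (by nlinarith)]
  · have hq : invSqrt 1 = 1 := by simp [invSqrt]
    have hF : profile (1 / 4) 1 = 2 := by
      rw [profile_eq ha₁ (by norm_num), hq]; norm_num
    have hF' : profileSlope (1 / 4) 1 = -(1 / 2) := by
      rw [profileSlope_eq ha₁ (by norm_num), hq]; norm_num
    have hF'' : deriv (profileSlope (1 / 4)) 1 = 3 / 4 := by
      rw [deriv_profileSlope_eq ha₁ (by norm_num), hq]; norm_num
    refine h₁.containsStableMinimalSphere ?_ ?_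
    · rw [deriv_profile ha₁, hF, hF']; norm_num
    -- The value is `3/2 - 1/4 = 5/4`.
    · rw [h₁.deriv_christoffelCoeff, deriv_profile ha₁, hF, hF', hF'']; norm_num
  · rintro ⟨S, _, _, _, _, _, _, f, hf, hmin⟩
    refine h₂.not_isMinimal (fun t => ?_) hf hmin
    rw [deriv_profile ha₂]
    exact profile_meanConvex le_rfl
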